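/- All graphs are finite and simple. A connected dominating set of a graph $G$ is a set $D\subseteq V(G)$ such that every vertex of $G$ lies in $D$ or has a neighbour in $D$ and the induced subgraph $G[D]$ is connected (and nonempty); the connected domination number $\gamma_c(G)$ is the least cardinality of a connected dominating set, with $\gamma_c(G)=\infty$ if there is none (that is, if $G$ is disconnected). For $k\in\mathbb N$, $G$ is $k$-$\gamma_c$-edge critical if $\gamma_c(G)=k$ and $\gamma_c(G+uv)<k$ for every pair of distinct non-adjacent vertices $u,v$; $G$ is $k$-$\gamma_c$-vertex critical if $\gamma_c(G)=k$ and $\gamma_c(G-v)<k$ for every vertex $v$; and $G$ is maximal $k$-$\gamma_c$-vertex critical if it is both. Let $\alpha(G)$ be the independence number and $\delta(G)$ the minimum degree of $G$. For $l\ge 2$ let $\mathcal G_1(l)$ be the class of the graphs isomorphic to the graph with the $2l+1$ vertices $v,z_1,\dots,z_l,q_1,\dots,q_l$ in which $v$ is adjacent exactly to $z_1,\dots,z_l$, the $z_i$ are pairwise non-adjacent, the $q_i$ are pairwise adjacent, and $z_i$ is adjacent to $q_j$ if and only if $i\ne j$. **Theorem.** Every maximal $3$-$\gamma_c$-vertex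 critical graph $G$ satisfies $\alpha(G)\le\delta(G)$. The bound is sharp: for every $l\ge 2$, the graph $G\in\mathcal G_1(l)$ is maximal $3$-$\gamma_c$-vertex critical, its vertex $v$ has minimum degree, $N_G(v)$ is a maximum independent set, and $\alpha(G)=\delta(G)=l$. -/

import Mathlib

universe u

namespace SimpleGraph

/-- `D` is a connected dominating set of `G`: every vertex lies in `D` or has a neighbour in `D`,
and the subgraph of `G` induced by `D` is connected (in particular `D` is nonempty). -/
def IsConnDomSet {V : Type*} (G : SimpleGraph V) (D : Set V) : Prop :=
  (∀ v, v ∈ D ∨ ∃ u ∈ D, G.Adj u v) ∧ (G.induce D).Connected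

/-- The connected domination number `γ_c(G)`: the least cardinality of a connected dominating set
of `G`, with the value `⊤` if `G` has none (for finite `G`, if `G` is not connected). -/
noncomputable def connDomNumber {V : Type*} (G : SimpleGraph V) : ℕ∞ :=
  ⨅ (D : Set V) (_ : G.IsConnDomSet D), D.encard

/-- `G` is `k`-`γ_c`-edge critical: `γ_c(G) = k`, and `γ_c(G + uv) < k` for each pair of distinct
non-adjacent vertices `u`, `v`. -/
def IsConnDomEdgeCritical {V : Type*} (k : ℕ) (G : SimpleGraph V) : Prop :=
  G.connDomNumber = k ∧
    ∀ u v : V, u ≠ v → ¬ G.Adj u v → (G ⊔ edge u v).connDomNumber < k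

/-- `G` is `k`-`γ_c`-vertex critical: `γ_c(G) = k`, and `γ_c(G - v) < k` for each vertex `v`.
As a disconnected graph has no connected dominating set, such a `G` has no cut vertex. -/
def IsConnDomVertexCritical {V : Type*} (k : ℕ) (G : SimpleGraph V) : Prop :=
  G.connDomNumber = k ∧
    ∀ v : V, (G.induce ({v}ᶜ : Set V)).connDomNumber < k

/-- `G` is maximal `k`-`γ_c`-vertex critical: both edge critical and vertex critical. -/
def IsMaximalConnDomVertexCritical {V : Type*} (k : ℕ) (G : SimpleGraph V) : Prop :=
  G.IsConnDomEdgeCritical k ∧ G.IsConnDomVertexCritical k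

end SimpleGraph

/-- The vertices `v`, `z_i`, `q_i` (`i : Fin l`) of the graph in the class `𝒢₁(l)`. -/
abbrev ClassG1Vertex (l : ℕ) : Type := Unit ⊕ (Fin l ⊕ Fin l)

namespace ClassG1Vertex

/-- The vertex `v`. -/
abbrev v (l : ℕ) : ClassG1Vertex l := Sum.inl ()

/-- The vertex `z_i`. -/
abbrev z {l : ℕ} (i : Fin l) : ClassG1Vertex l := Sum.inr (Sum.inl i)

/-- The vertex `q_i`. -/
abbrev q {l : ℕ} (i : Fin l) : ClassG1Vertex l := Sum.inr (Sum.inr i)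

end ClassG1Vertex

/-- Adjacency in `v ∨ K̄_l ∨ K_l - z_1 q_1 - ⋯ - z_l q_l`: the vertex `v` is joined to all `z_i`, the
vertex `z_i` is joined to `q_j` exactly for `i ≠ j`, and the `q_i` are pairwise adjacent. -/
def classG1Adj {l : ℕ} : ClassG1Vertex l → ClassG1Vertex l → Prop
  | .inl _, .inl _ => False
  | .inl _, .inr (.inl _) => True
  | .inl _, .inr (.inr _) => False
  | .inr (.inl _), .inl _ => True
  | .inr (.inl _), .inr (.inl _) => False
  | .inr (.inl i), .inr (.inr j) => i ≠ j
  | .inr (.inr _), .inl _ => False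
  | .inr (.inr i), .inr (.inl j) => i ≠ j
  | .inr (.inr i), .inr (.inr j) => i ≠ j

instance {l : ℕ} : DecidableRel (classG1Adj (l := l)) := fun a b => by
  rcases a with _ | i | i <;> rcases b with _ | j | j <;> unfold classG1Adj <;> infer_instance

/-- The graph (unique up to isomorphism) in the class `𝒢₁(l)`. -/
def classG1 (l : ℕ) : SimpleGraph (ClassG1Vertex l) where
  Adj := classG1Adj
  symm := ⟨fun a b h => by
    rcases a with _ | i | i <;> rcases b with _ | j | j <;>
      simp_all [classG1Adj, eq_comm]⟩
  loopless := ⟨fun a h => by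
    rcases a with _ | i | i <;> simp [classG1Adj] at h⟩

instance (l : ℕ) : DecidableRel (classG1 l).Adj :=
  inferInstanceAs (DecidableRel (classG1Adj (l := l)))

/-! ### Connected dominating sets of size at most two -/

namespace SimpleGraph

variable {V : Type*} {G : SimpleGraph V}

/-! Vertex criticality gives, for every `v`, an edge `ab` that dominates everything except `v`; one
of its ends lies in the closed neighbourhood of any prescribed `x ≠ v`. Edge criticality gives, for
non-adjacent `u, w` with a common non-neighbour, a witness `y` adjacent to one of them, say `u`,
such that `uy` dominates everything except `w`. If `u, w` lie in an independent set `I`, then `y` is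
adjacent to all of `I` except `w`, so witnesses missing different vertices are different.

Suppose `deg x < |I|` with `|I| ≥ 3`. If `x ∈ I` or `x` misses at least two vertices of `I`,
counting shows that every neighbour of `x` is one of a clique of witnesses or is adjacent to all of
them. The edge that misses one such witness then has no end near `x` (`false_of_witness_family`). If
`x ∉ I` misses exactly one vertex of `I`, then `N(x) ⊆ I`, and vertex criticality alone yields a
contradiction. For `|I| ≤ 2` it suffices that all degrees are at least 2.

In the sharpness example `|N(v)| = l` with `N(v)` independent, so the bound itself yields both `δ =
l` and `α = l`. -/

/-- `p` and `q` are equal or adjacent, and `{p, q}` is a dominating set. -/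
def IsDomPair (G : SimpleGraph V) (p q : V) : Prop :=
  (p = q ∨ G.Adj p q) ∧ ∀ z, z = p ∨ z = q ∨ G.Adj p z ∨ G.Adj q z

theorem IsConnDomSet.exists_adj {D : Set V} (hD : G.IsConnDomSet D) {p q : V} (hp : p ∈ D)
    (hq : q ∈ D) (hpq : p ≠ q) : ∃ r ∈ D, G.Adj p r := by
  have : Nontrivial D := ⟨⟨p, hp⟩, ⟨q, hq⟩, fun h => hpq (congrArg Subtype.val h)⟩
  obtain ⟨r, hr⟩ := hD.2.preconnected.exists_adj_of_nontrivial ⟨p, hp⟩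
  exact ⟨r, r.2, hr⟩

theorem IsDomPair.isConnDomSet {p q : V} (h : G.IsDomPair p q) : G.IsConnDomSet {p, q} := by
  refine ⟨fun z => ?_, ?_⟩
  · rcases h.2 z with h | h | h | h <;> simp [h]
  · rcases h.1 with rfl | h
    · have : (({p, p} : Set V)).Subsingleton := by simp
      have : Subsingleton ({p, p} : Set V) := this.coe_sort
      have : Nonempty ({p, p} : Set V) := ⟨⟨p, by simp⟩⟩
      exact ⟨Preconnected.of_subsingleton⟩
    · exact induce_pair_connected_of_adj h

theorem connDomNumber_le {D : Set V} (hD : G.IsConnDomSet D) : G.connDomNumber ≤ D.encard :=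
  iInf₂_le D hD

theorem connDomNumber_lt_three_iff : G.connDomNumber < 3 ↔ ∃ p q, G.IsDomPair p q := by
  constructor
  · intro h
    simp only [connDomNumber, iInf_lt_iff] at h
    obtain ⟨D, hD, hlt⟩ := h
    obtain ⟨p, hp⟩ := Set.nonempty_coe_sort.1 hD.2.nonempty
    by_cases hq : ∃ q ∈ D, q ≠ p
    · obtain ⟨q, hq, hqp⟩ := hq
      have hsub : ({p, q} : Set V) ⊆ D := by
        rintro z (rfl | rfl) <;> assumption
      -- Fewer than three elements leaves no room beyond `p` and `q`; connectedness then supplies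
      -- the edge between them.
      have hDeq : D = {p, q} := by
        by_contra hne
        have hss : ({p, q} : Set V) ⊂ D := hsub.ssubset_of_ne (Ne.symm hne)
        have h1 := (Set.toFinite ({p, q} : Set V)).encard_lt_encard hss
        rw [Set.encard_pair hqp.symm] at h1
        have := Order.add_one_le_of_lt h1
        rw [show (2 : ℕ∞) + 1 = 3 by norm_num] at this
        exact absurd hlt (not_lt.2 this)
      obtain ⟨r, hr, hpr⟩ := hD.exists_adj hp hq hqp.symm
      have hrq : r = q := by
        rw [hDeq] at hr
        rcases hr with rfl | hr
        · exact absurd hpr (G.irrefl)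
        · exact hr
      subst hrq
      refine ⟨p, r, Or.inr hpr, fun z => ?_⟩
      have := hD.1 z
      rw [hDeq] at this
      simpa [or_assoc] using this
    · push Not at hq
      refine ⟨p, p, Or.inl rfl, fun z => ?_⟩
      rcases hD.1 z with hz | ⟨u, hu, huz⟩
      · exact Or.inl (hq z hz)
      · rw [hq u hu] at huz
        exact Or.inr (Or.inr (Or.inl huz))
  · rintro ⟨p, q, h⟩
    refine (connDomNumber_le h.isConnDomSet).trans_lt ?_
    refine (Set.encard_insert_le _ _).trans_lt ?_
    rw [Set.encard_singleton]
    norm_num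

/-! ### Consequences of vertex and edge criticality -/

/-- `a` and `b` are adjacent, and `{a, b}` dominates every vertex but `v`. -/
structure IsMissPair (G : SimpleGraph V) (v a b : V) : Prop where
  adj : G.Adj a b
  ne_left : a ≠ v
  ne_right : b ≠ v
  not_adj_left : ¬ G.Adj a v
  not_adj_right : ¬ G.Adj b v
  dom : ∀ z, z ≠ v → z = a ∨ z = b ∨ G.Adj a z ∨ G.Adj b z

theorem IsMissPair.symm {v a b : V} (h : G.IsMissPair v a b) : G.IsMissPair v b a :=
  ⟨h.adj.symm, h.ne_right, h.ne_left, h.not_adj_right, h.not_adj_left, fun z hz => by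
    have := h.dom z hz
    tauto⟩

theorem exists_adj_of_connDomNumber_eq_three (h : G.connDomNumber = 3) (v : V) :
    ∃ c, G.Adj v c := by
  have hnt : G.connDomNumber < ⊤ := by rw [h]; exact ENat.natCast_lt_top 3
  have hno : ¬ ∃ p q, G.IsDomPair p q := by
    rw [← connDomNumber_lt_three_iff, h]; exact lt_irrefl _
  simp only [connDomNumber, iInf_lt_iff] at hnt
  obtain ⟨D, hD, -⟩ := hnt
  rcases hD.1 v with hv | ⟨u, -, hu⟩
  · by_cases hq : ∃ q ∈ D, q ≠ v
    · obtain ⟨q, hq, hqv⟩ := hq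
      obtain ⟨r, -, hr⟩ := hD.exists_adj hv hq hqv.symm
      exact ⟨r, hr⟩
    · push Not at hq
      refine absurd ⟨v, v, Or.inl rfl, fun z => ?_⟩ hno
      rcases hD.1 z with hz | ⟨u, hu, huz⟩
      · exact Or.inl (hq z hz)
      · rw [hq u hu] at huz
        exact Or.inr (Or.inr (Or.inl huz))
  · exact ⟨u, hu.symm⟩

theorem IsConnDomVertexCritical.exists_isMissPair (h : G.IsConnDomVertexCritical 3) (v : V) :
    ∃ a b, G.IsMissPair v a b := by
  have h3 : G.connDomNumber = 3 := h.1
  have hno : ¬ ∃ p q, G.IsDomPair p q := by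
    rw [← connDomNumber_lt_three_iff, h3]; exact lt_irrefl _
  obtain ⟨⟨a, ha⟩, ⟨b, hb⟩, hab, hdom⟩ := connDomNumber_lt_three_iff.1 (h.2 v)
  simp only [Set.mem_compl_iff, Set.mem_singleton_iff, Subtype.forall, Subtype.mk.injEq,
    comap_adj, Function.Embedding.subtype_apply] at ha hb hab hdom
  obtain ⟨c, hc⟩ := exists_adj_of_connDomNumber_eq_three h3 v
  have key : ¬ (a = b ∨ G.Adj a b) ∨ (¬ G.Adj a v ∧ ¬ G.Adj b v) := by
    by_contra hcon
    refine hno ⟨a, b, by tauto, fun z => ?_⟩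
    by_cases hz : z = v
    · subst hz; tauto
    · exact hdom z hz
  have hab' : a ≠ b := by
    rintro rfl
    -- If `a` alone dominates `G - v`, adding a neighbour `c` of `v` gives a dominating pair of `G`.
    refine hno ⟨a, c, ?_, fun z => ?_⟩
    · have := hdom c hc.ne'
      tauto
    · by_cases hz : z = v
      · subst hz; exact Or.inr (Or.inr (Or.inr hc.symm))
      · have := hdom z hz
        tauto
  exact ⟨a, b, by tauto, ha, hb, by tauto, by tauto, fun z hz => hdom z hz⟩

theorem exists_isMissPair_near (hV : ∀ v, ∃ a b, G.IsMissPair v a b) {v x : V} (hx : x ≠ v) :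
    ∃ a b, G.IsMissPair v a b ∧ (a = x ∨ G.Adj x a) := by
  obtain ⟨a, b, h⟩ := hV v
  rcases h.dom x hx with h1 | h1 | h1 | h1
  · exact ⟨a, b, h, Or.inl h1.symm⟩
  · exact ⟨b, a, h.symm, Or.inl h1.symm⟩
  · exact ⟨a, b, h, Or.inr h1.symm⟩
  · exact ⟨b, a, h.symm, Or.inr h1.symm⟩

/-- `u` and `y` are adjacent, and `{u, y}` dominates every vertex but `w`. -/
structure IsWitness (G : SimpleGraph V) (u w y : V) : Prop where
  adj : G.Adj u y
  not_adj : ¬ G.Adj y w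
  dom : ∀ z, z ≠ w → z = u ∨ z = y ∨ G.Adj u z ∨ G.Adj y z

/-- A dominating pair of `G + uw` must use `u` or `w`, since otherwise it already works in `G`. It
is neither `{u, w}` nor a single one of these vertices, because `t` would stay undominated. -/
theorem IsConnDomEdgeCritical.exists_isWitness (h : G.IsConnDomEdgeCritical 3) {u w t : V}
    (huw : u ≠ w) (hnuw : ¬ G.Adj u w) (htu : t ≠ u) (htw : t ≠ w) (hnut : ¬ G.Adj u t)
    (hnwt : ¬ G.Adj w t) : (∃ y, G.IsWitness u w y) ∨ ∃ y, G.IsWitness w u y := by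
  have h3 : G.connDomNumber = 3 := h.1
  have hno : ∀ p q, ¬ G.IsDomPair p q := by
    intro p q hpq
    have := connDomNumber_lt_three_iff.2 ⟨p, q, hpq⟩
    rw [h3] at this
    exact lt_irrefl _ this
  have aux : ∀ u w q : V, u ≠ w → (w ≠ q) → t ≠ u → t ≠ w → ¬ G.Adj u t → ¬ G.Adj w t →
      (u = q ∨ G.Adj u q) → (∀ z, z ≠ w → z = u ∨ z = q ∨ G.Adj u z ∨ G.Adj q z) →
      ∃ y, G.IsWitness u w y := by
    intro u w q huw hwq htu htw hnut hnwt huq hdom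
    rcases huq with rfl | huq
    · exact absurd (hdom t htw) (by tauto)
    · refine ⟨q, huq, fun hqw => hno u q ⟨Or.inr huq, fun z => ?_⟩, hdom⟩
      by_cases hz : z = w
      · subst hz; tauto
      · exact hdom z hz
  obtain ⟨p, q, hpq, hdom⟩ := connDomNumber_lt_three_iff.1 (h.2 u w huw hnuw)
  simp only [sup_adj, edge_adj] at hpq hdom
  have ht := hdom t
  by_cases hpu : p = u
  · subst hpu
    have : w ≠ q := by grind
    exact Or.inl (aux p w q huw this htu htw hnut hnwt (by grind) (fun z hz => by grind))
  by_cases hpw : p = w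
  · subst hpw
    have : u ≠ q := by grind
    exact Or.inr (aux p u q huw.symm this htw htu hnwt hnut (by grind) (fun z hz => by grind))
  by_cases hqu : q = u
  · subst hqu
    exact Or.inl (aux q w p huw (Ne.symm hpw) htu htw hnut hnwt
      (by grind [G.adj_comm]) (fun z hz => by grind))
  by_cases hqw : q = w
  · subst hqw
    exact Or.inr (aux q u p huw.symm (Ne.symm hpu) htw htu hnwt hnut
      (by grind [G.adj_comm]) (fun z hz => by grind))
  exact absurd ⟨by grind, fun z => by grind⟩ (hno p q)

theorem IsWitness.adj_of_not_adj {u w y z : V} (h : G.IsWitness u w y) (hzw : z ≠ w) (hzu : z ≠ u)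
    (hzy : z ≠ y) (huz : ¬ G.Adj u z) : G.Adj y z := by
  have := h.dom z hzw
  tauto

/-! ### Independent sets larger than the degree of a vertex -/

section Independent

variable {I : Finset V}

theorem IsIndepSet.not_adj {s : Set V} (h : G.IsIndepSet s) {a b : V} (ha : a ∈ s) (hb : b ∈ s) :
    ¬ G.Adj a b := fun hab => h ha hb hab.ne hab

theorem IsWitness.notMem (hI : G.IsIndepSet I) {u w y : V} (h : G.IsWitness u w y) (hu : u ∈ I) :
    y ∉ I := fun hy => hI.not_adj hu hy h.adj

theorem IsWitness.adj_mem (hI : G.IsIndepSet I) {u w y t : V} (h : G.IsWitness u w y) (hu : u ∈ I)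
    (ht : t ∈ I) (htw : t ≠ w) : G.Adj y t := by
  by_cases htu : t = u
  · exact htu ▸ h.adj.symm
  · exact h.adj_of_not_adj htw htu (fun hty => h.notMem hI hu (hty ▸ ht)) (hI.not_adj hu ht)

/-- A family of witnesses `y w` for `w ∈ T ⊆ I` forms a clique if it contains every witness of a
pair in `T`; so the neighbourhood of `x` does not consist of these and of common neighbours
of them. -/
theorem false_of_witness_family
    (hV : ∀ v, ∃ a b, G.IsMissPair v a b)
    (hE : ∀ u ∈ I, ∀ w ∈ I, u ≠ w → (∃ y, G.IsWitness u w y) ∨ ∃ y, G.IsWitness w u y)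
    {T : Finset V} (hTI : T ⊆ I) (hT : T.Nonempty) {x : V} {y : V → V}
    (hyx : ∀ w ∈ T, G.Adj x (y w))
    (hyI : ∀ w ∈ T, y w ∉ I) (hyw : ∀ w ∈ T, ¬ G.Adj (y w) w)
    (huniq : ∀ u ∈ T, ∀ w ∈ T, u ≠ w → ∀ y', G.IsWitness u w y' → y' = y w)
    (hx : ∀ p, G.Adj x p → (∃ w ∈ T, p = y w) ∨ ∀ w ∈ T, G.Adj p (y w)) : False := by
  have step : ∀ u ∈ T, ∀ w ∈ T, u ≠ w → ∀ y', G.IsWitness u w y' → y u ≠ y w →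
      G.Adj (y w) (y u) := by
    intro u hu w hw huw y' hy' hne
    -- The edge from `u` to `y w` dominates `y u`, and `u` is not adjacent to `y u`.
    obtain rfl := huniq u hu w hw huw y' hy'
    refine hy'.adj_of_not_adj ?_ ?_ hne (fun h => hyw u hu h.symm)
    · exact fun h => hyI u hu (h.symm ▸ hTI hw)
    · exact fun h => hyI u hu (h.symm ▸ hTI hu)
  have clique : ∀ u ∈ T, ∀ w ∈ T, y u ≠ y w → G.Adj (y u) (y w) := by
    intro u hu w hw hne
    have huw : u ≠ w := fun h => hne (h ▸ rfl)
    rcases hE u (hTI hu) w (hTI hw) huw with ⟨y', h⟩ | ⟨y', h⟩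
    · exact (step u hu w hw huw y' h hne).symm
    · exact step w hw u hu huw.symm y' h hne.symm
  obtain ⟨w, hw⟩ := hT
  -- The edge missing `y w` would need an end in the closed neighbourhood of `x`, but all vertices
  -- there are equal or adjacent to `y w`.
  obtain ⟨p, q, hpq, hp⟩ := exists_isMissPair_near hV (hyx w hw).ne
  rcases hp with rfl | hp
  · exact hpq.not_adj_left (hyx w hw)
  · rcases hx p hp with ⟨w', hw', rfl⟩ | h
    · exact hpq.not_adj_left (clique w' hw' w hw hpq.ne_left)
    · exact hpq.not_adj_left (h w hw)

theorem card_le_degree_of_mem [DecidableEq V] [Fintype V] [DecidableRel G.Adj]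
    (hI : G.IsIndepSet I) (hI3 : 3 ≤ I.card)
    (hV : ∀ v, ∃ a b, G.IsMissPair v a b)
    (hE : ∀ u ∈ I, ∀ w ∈ I, u ≠ w → (∃ y, G.IsWitness u w y) ∨ ∃ y, G.IsWitness w u y)
    {x : V} (hx : x ∈ I) : I.card ≤ G.degree x := by
  by_contra! hdeg
  rw [← card_neighborFinset_eq_degree] at hdeg
  have hJ : (I.erase x).card = I.card - 1 := Finset.card_erase_of_mem hx
  -- If every `w ≠ x` in `I` is missed by a witness, these `|I| - 1` witnesses exhaust `N(x)`.
  -- Otherwise some `s` is never missed, so `s` has a witness against every other vertex of `I`.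
  by_cases hsrc : ∀ w ∈ I.erase x, ∃ y, ∃ u ∈ I, G.IsWitness u w y
  · choose! y u hu hy using hsrc
    have hyx : ∀ w ∈ I.erase x, G.Adj x (y w) := fun w hw =>
      ((hy w hw).adj_mem hI (hu w hw) hx (Finset.ne_of_mem_erase hw).symm).symm
    have hinj : Set.InjOn y (I.erase x) := by
      intro a ha b hb hab
      by_contra hne
      refine (hy b hb).not_adj ?_
      rw [← hab]
      exact (hy a ha).adj_mem hI (hu a ha) (Finset.mem_of_mem_erase hb) (Ne.symm hne)
    have himg : (I.erase x).image y = G.neighborFinset x := by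
      refine Finset.eq_of_subset_of_card_le ?_ ?_
      · intro p hp
        obtain ⟨w, hw, rfl⟩ := Finset.mem_image.1 hp
        simpa using hyx w hw
      · rw [Finset.card_image_of_injOn hinj]; omega
    have hN : ∀ p, G.Adj x p → ∃ w ∈ I.erase x, p = y w := by
      intro p hp
      have : p ∈ (I.erase x).image y := by rw [himg]; simpa using hp
      obtain ⟨w, hw, rfl⟩ := Finset.mem_image.1 this
      exact ⟨w, hw, rfl⟩
    refine false_of_witness_family hV hE (Finset.erase_subset x I)
      (Finset.card_pos.1 (by omega)) hyx (fun w hw => (hy w hw).notMem hI (hu w hw))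
      (fun w hw => (hy w hw).not_adj) ?_ (fun p hp => Or.inl (hN p hp))
    intro a ha b hb hab y' hy'
    have ha' := Finset.mem_of_mem_erase ha
    have hb' := Finset.mem_of_mem_erase hb
    obtain ⟨w, hw, rfl⟩ := hN y' (hy'.adj_mem hI ha' hx (Finset.ne_of_mem_erase hb).symm).symm
    by_contra hne
    refine (hy w hw).not_adj (hy'.adj_mem hI ha' (Finset.mem_of_mem_erase hw) ?_)
    rintro rfl
    exact hne rfl
  · push Not at hsrc
    obtain ⟨s, hs, hsrc⟩ := hsrc
    have hsI := Finset.mem_of_mem_erase hs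
    have hsx := Finset.ne_of_mem_erase hs
    have hout : ∀ w ∈ I.erase s, ∃ y, G.IsWitness s w y := by
      intro w hw
      rcases hE s hsI w (Finset.mem_of_mem_erase hw) (Finset.ne_of_mem_erase hw).symm with h | ⟨y, h⟩
      · exact h
      · exact absurd h (hsrc y w (Finset.mem_of_mem_erase hw))
    choose! y hy using hout
    -- The witnesses for `T` are adjacent to `s`, so `c` is the single remaining neighbour of `x`;
    -- as `s` misses `c`, every such witness is adjacent to `c`.
    obtain ⟨c, hxc, hcs, hnc⟩ : ∃ c, G.Adj x c ∧ c ≠ s ∧ ¬ G.Adj c s := by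
      obtain ⟨p, q, h, hp⟩ := exists_isMissPair_near hV hsx.symm
      rcases hp with rfl | hp
      · exact ⟨q, h.adj, h.ne_right, h.not_adj_right⟩
      · exact ⟨p, hp, h.ne_left, h.not_adj_left⟩
    have hcI : c ∉ I := fun hc => hI.not_adj hx hc hxc
    set T := (I.erase s).erase x with hTdef
    have hTs : ∀ w ∈ T, w ∈ I.erase s := fun w hw => Finset.mem_of_mem_erase hw
    have hTI : T ⊆ I := fun w hw => Finset.mem_of_mem_erase (hTs w hw)
    have hTx : ∀ w ∈ T, x ≠ w := fun w hw => (Finset.ne_of_mem_erase hw).symm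
    have hTne : ∀ w ∈ T, s ≠ w := fun w hw => (Finset.ne_of_mem_erase (hTs w hw)).symm
    have hTcard : T.card = I.card - 2 := by
      rw [hTdef, Finset.card_erase_of_mem (Finset.mem_erase.2 ⟨hsx.symm, hx⟩),
        Finset.card_erase_of_mem hsI]
      omega
    have hyx : ∀ w ∈ T, G.Adj x (y w) := fun w hw =>
      ((hy w (hTs w hw)).adj_mem hI hsI hx (hTx w hw)).symm
    have hinj : Set.InjOn y T := by
      intro a ha b hb hab
      by_contra hne
      refine (hy b (hTs b hb)).not_adj ?_
      rw [← hab]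
      exact (hy a (hTs a ha)).adj_mem hI hsI (hTI hb) (Ne.symm hne)
    have himg : T.image y = (G.neighborFinset x).erase c := by
      refine Finset.eq_of_subset_of_card_le ?_ ?_
      · intro p hp
        obtain ⟨w, hw, rfl⟩ := Finset.mem_image.1 hp
        refine Finset.mem_erase.2 ⟨?_, by simpa using hyx w hw⟩
        rintro rfl
        exact hnc (hy w (hTs w hw)).adj.symm
      · rw [Finset.card_image_of_injOn hinj, Finset.card_erase_of_mem (by simpa using hxc)]
        omega
    have hN : ∀ p, G.Adj x p → p ≠ c → ∃ w ∈ T, p = y w := by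
      intro p hp hpc
      have : p ∈ T.image y := by rw [himg]; simpa [hpc] using hp
      obtain ⟨w, hw, rfl⟩ := Finset.mem_image.1 this
      exact ⟨w, hw, rfl⟩
    refine false_of_witness_family hV hE hTI
      (Finset.card_pos.1 (by omega)) hyx (fun w hw => (hy w (hTs w hw)).notMem hI hsI)
      (fun w hw => (hy w (hTs w hw)).not_adj) ?_ (fun p hp => ?_)
    · intro a ha b hb hab y' hy'
      have hys := hy'.adj_mem hI (hTI ha) hsI (hTne b hb)
      obtain ⟨w, hw, rfl⟩ := hN y' (hy'.adj_mem hI (hTI ha) hx (hTx b hb)).symm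
        (fun h => hnc (h ▸ hys))
      by_contra hne
      refine (hy w (hTs w hw)).not_adj (hy'.adj_mem hI (hTI ha) (hTI hw) ?_)
      rintro rfl
      exact hne rfl
    · by_cases hpc : p = c
      · subst hpc
        refine Or.inr fun w hw => ((hy w (hTs w hw)).adj_of_not_adj ?_ hcs ?_
          (fun h => hnc h.symm)).symm
        · exact fun h => hcI (h ▸ hTI hw)
        · rintro rfl
          exact hnc (hy w (hTs w hw)).adj.symm
      · exact Or.inl (hN p hp hpc)

/-- A small degree forces `N(x) = I \ {w}`. Missing some `u` in it yields `b` adjacent to all of `I`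
except `u`; missing `b` then yields `q` adjacent to all of `I`. The edge missing `q` has no end near
`x`. -/
theorem card_le_degree_of_one_nonneighbor [DecidableEq V] [Fintype V] [DecidableRel G.Adj]
    (hI : G.IsIndepSet I) (hI2 : 2 ≤ I.card)
    (hV : ∀ v, ∃ a b, G.IsMissPair v a b)
    {x w : V} (hx : x ∉ I) (hw : w ∈ I) (hxw : ¬ G.Adj x w)
    (hA : ∀ u ∈ I, u ≠ w → G.Adj x u) : I.card ≤ G.degree x := by
  by_contra! hdeg
  rw [← card_neighborFinset_eq_degree] at hdeg
  have hcard : (I.erase w).card = I.card - 1 := Finset.card_erase_of_mem hw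
  have hN : I.erase w = G.neighborFinset x := by
    refine Finset.eq_of_subset_of_card_le (fun u hu => ?_) (by omega)
    simpa using hA u (Finset.mem_of_mem_erase hu) (Finset.ne_of_mem_erase hu)
  replace hN : ∀ p, G.Adj x p → p ∈ I ∧ p ≠ w := by
    intro p hp
    have : p ∈ I.erase w := by rw [hN]; simpa using hp
    exact ⟨Finset.mem_of_mem_erase this, Finset.ne_of_mem_erase this⟩
  have hwx : w ≠ x := fun h => hx (h ▸ hw)
  obtain ⟨u, hu⟩ : (I.erase w).Nonempty := Finset.card_pos.1 (by omega)
  have huI := Finset.mem_of_mem_erase hu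
  have huw := Finset.ne_of_mem_erase hu
  have hxu := hA u huI huw
  obtain ⟨a, b, hab, ha⟩ := exists_isMissPair_near hV hxu.ne
  replace ha : G.Adj x a := ha.resolve_left (fun h => hab.not_adj_left (h ▸ hxu))
  obtain ⟨haI, haw⟩ := hN a ha
  have hbI : b ∉ I := fun hb => hI.not_adj haI hb hab.adj
  have hbt : ∀ t ∈ I, t ≠ u → G.Adj b t := by
    intro t ht htu
    by_cases hta : t = a
    · exact hta ▸ hab.adj.symm
    · have := hab.dom t htu
      have h1 := hI.not_adj haI ht
      have h2 : t ≠ b := fun h => hbI (h ▸ ht)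
      tauto
  have hbx : x ≠ b := fun h => hxw (h ▸ hbt w hw huw.symm)
  obtain ⟨p, q, hpq, hp⟩ := exists_isMissPair_near hV hbx
  have hpu : G.Adj x p ∧ p = u := by
    rcases hp with rfl | hp
    · obtain ⟨hq, hqw⟩ := hN q hpq.adj
      have hqu : q = u := by
        by_contra hqu
        exact hpq.not_adj_right (hbt q hq hqu).symm
      subst hqu
      -- The pair would be `x, u`, which leaves `w` undominated.
      have h1 := hpq.dom w (fun h => hbI (h ▸ hw))
      have h2 := hI.not_adj hq hw
      have h3 := hqw.symm
      tauto
    · refine ⟨hp, ?_⟩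
      by_contra hqu
      exact hpq.not_adj_left (hbt p (hN p hp).1 hqu).symm
  obtain ⟨-, rfl⟩ := hpu
  have hqI : q ∉ I := fun hq => hI.not_adj huI hq hpq.adj
  have hqt : ∀ t ∈ I, G.Adj q t := by
    intro t ht
    by_cases htp : t = p
    · exact htp ▸ hpq.adj.symm
    · have := hpq.dom t (fun h => hbI (h ▸ ht))
      have h1 := hI.not_adj huI ht
      have h2 : t ≠ q := fun h => hqI (h ▸ ht)
      tauto
  obtain ⟨r, s, hrs, hr⟩ := exists_isMissPair_near hV (v := q) (x := x)
    (fun h => hxw (h ▸ hqt w hw))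
  rcases hr with rfl | hr
  · exact hrs.not_adj_right (hqt s (hN s hrs.adj).1).symm
  · exact hrs.not_adj_left (hqt r (hN r hr).1).symm

theorem card_le_degree_of_two_nonneighbors [DecidableEq V] [Fintype V] [DecidableRel G.Adj]
    (hI : G.IsIndepSet I) (hV : ∀ v, ∃ a b, G.IsMissPair v a b)
    (hE : ∀ u ∈ I, ∀ w ∈ I, u ≠ w → (∃ y, G.IsWitness u w y) ∨ ∃ y, G.IsWitness w u y)
    {x : V} (hx : x ∉ I) (hB2 : 2 ≤ (I \ G.neighborFinset x).card) : I.card ≤ G.degree x := by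
  by_contra! hdeg
  rw [← card_neighborFinset_eq_degree] at hdeg
  set B := I \ G.neighborFinset x with hB
  set C := G.neighborFinset x \ I with hC
  have hCB : C.card + 1 ≤ B.card := by
    have h1 := Finset.card_sdiff_add_card_inter I (G.neighborFinset x)
    have h2 := Finset.card_sdiff_add_card_inter (G.neighborFinset x) I
    rw [← hB] at h1
    rw [← hC, Finset.inter_comm] at h2
    omega
  have hBI : ∀ {w}, w ∈ B → w ∈ I := fun h => (Finset.mem_sdiff.1 h).1
  have hBx : ∀ {w}, w ∈ B → ¬ G.Adj x w := fun h => by simpa using (Finset.mem_sdiff.1 h).2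
  -- A witness misses only one vertex of `I`, so it is not `x`, which misses two; as `u` misses `x`,
  -- the witness must dominate `x`.
  have hwC : ∀ u ∈ B, ∀ w ∈ I, ∀ y, G.IsWitness u w y → y ∈ C := by
    intro u hu w hw y hy
    have hyx : x ≠ y := by
      rintro rfl
      obtain ⟨b, hb, hbw⟩ := Finset.exists_mem_ne (by omega : 1 < B.card) w
      exact hBx hb (hy.adj_mem hI (hBI hu) (hBI hb) hbw)
    have := hy.adj_of_not_adj (z := x) (fun h => hx (h ▸ hw)) (fun h => hx (h ▸ hBI hu)) hyx
      (fun h => hBx hu h.symm)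
    simp [hC, this.symm, hy.notMem hI (hBI hu)]
  classical
  set T := B.filter (fun w => ∃ y, ∃ u ∈ B, G.IsWitness u w y) with hT
  have hTB : ∀ {w}, w ∈ T → w ∈ B := fun h => (Finset.mem_filter.1 h).1
  -- Of any two vertices of `B`, one is missed by a witness of the other. Hence `|T| ≥ |B| - 1 ≥
  -- |C|`, and the witnesses fill `C`.
  have hTcard : B.card ≤ T.card + 1 := by
    have h1 : (B \ T).card ≤ 1 := by
      refine Finset.card_le_one.2 fun a ha b hb => ?_
      by_contra hab
      simp only [hT, Finset.mem_sdiff, Finset.mem_filter, not_and] at ha hb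
      rcases hE a (hBI ha.1) b (hBI hb.1) hab with ⟨y, h⟩ | ⟨y, h⟩
      · exact hb.2 hb.1 ⟨y, a, ha.1, h⟩
      · exact ha.2 ha.1 ⟨y, b, hb.1, h⟩
    have h2 := Finset.card_sdiff_add_card_eq_card (s := T) (t := B) (Finset.filter_subset _ B)
    omega
  have hex : ∀ w ∈ T, ∃ y, ∃ u ∈ B, G.IsWitness u w y := fun w hw => (Finset.mem_filter.1 hw).2
  choose! y u hu hy using hex
  have hyC : ∀ w ∈ T, y w ∈ C := fun w hw => hwC _ (hu w hw) w (hBI (hTB hw)) _ (hy w hw)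
  have hyx : ∀ w ∈ T, G.Adj x (y w) := fun w hw => by
    simpa using (Finset.mem_sdiff.1 (hyC w hw)).1
  have hinj : Set.InjOn y T := by
    intro a ha b hb hab
    by_contra hne
    refine (hy b hb).not_adj ?_
    rw [← hab]
    exact (hy a ha).adj_mem hI (hBI (hu a ha)) (hBI (hTB hb)) (Ne.symm hne)
  have himg : T.image y = C := by
    refine Finset.eq_of_subset_of_card_le (Finset.image_subset_iff.2 hyC) ?_
    rw [Finset.card_image_of_injOn hinj]
    omega
  have hN : ∀ p ∈ C, ∃ w ∈ T, p = y w := by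
    intro p hp
    rw [← himg] at hp
    obtain ⟨w, hw, rfl⟩ := Finset.mem_image.1 hp
    exact ⟨w, hw, rfl⟩
  refine false_of_witness_family hV hE (fun w hw => hBI (hTB hw))
    (Finset.card_pos.1 (by omega)) hyx (fun w hw => (hy w hw).notMem hI (hBI (hu w hw)))
    (fun w hw => (hy w hw).not_adj) ?_ (fun p hp => ?_)
  · intro a ha b hb hab y' hy'
    obtain ⟨w, hw, rfl⟩ := hN y' (hwC a (hTB ha) b (hBI (hTB hb)) y' hy')
    by_contra hne
    refine (hy w hw).not_adj (hy'.adj_mem hI (hBI (hTB ha)) (hBI (hTB hw)) ?_)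
    rintro rfl
    exact hne rfl
  · by_cases hpI : p ∈ I
    · refine Or.inr fun w hw => ((hy w hw).adj_mem hI (hBI (hu w hw)) hpI ?_).symm
      rintro rfl
      exact hBx (hTB hw) hp
    · exact Or.inl (hN p (by simp [hC, hp, hpI]))

end Independent

/-- In a maximal `3`-`γ_c`-vertex critical graph, no independent set is larger than the degree of
a vertex. -/
theorem IsMaximalConnDomVertexCritical.card_le_degree [Fintype V] [DecidableRel G.Adj]
    (h : G.IsMaximalConnDomVertexCritical 3) {I : Finset V} (hI : G.IsIndepSet I) (x : V) :
    I.card ≤ G.degree x := by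
  classical
  have hV := h.2.exists_isMissPair
  by_cases hI3 : 3 ≤ I.card
  · have hE : ∀ u ∈ I, ∀ w ∈ I, u ≠ w →
        (∃ y, G.IsWitness u w y) ∨ ∃ y, G.IsWitness w u y := by
      intro u hu w hw huw
      obtain ⟨t, ht⟩ : ((I.erase u).erase w).Nonempty := by
        refine Finset.card_pos.1 ?_
        have h1 := Finset.pred_card_le_card_erase (s := I) (a := u)
        have h2 := Finset.pred_card_le_card_erase (s := I.erase u) (a := w)
        omega
      simp only [Finset.mem_erase] at ht
      exact h.1.exists_isWitness huw (hI.not_adj hu hw) ht.2.1 ht.1 (hI.not_adj hu ht.2.2)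
        (hI.not_adj hw ht.2.2)
    by_cases hx : x ∈ I
    · exact card_le_degree_of_mem hI hI3 hV hE hx
    · by_cases hB2 : 2 ≤ (I \ G.neighborFinset x).card
      · exact card_le_degree_of_two_nonneighbors hI hV hE hx hB2
      · have hB1 := Finset.card_le_one.1 (by omega : (I \ G.neighborFinset x).card ≤ 1)
        simp only [Finset.mem_sdiff, mem_neighborFinset] at hB1
        by_cases hB0 : ∀ u ∈ I, G.Adj x u
        · rw [← card_neighborFinset_eq_degree]
          exact Finset.card_le_card fun u hu => by simpa using hB0 u hu
        · push Not at hB0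
          obtain ⟨w, hw, hxw⟩ := hB0
          refine card_le_degree_of_one_nonneighbor hI (by omega) hV hx hw hxw fun u hu huw => ?_
          by_contra hxu
          exact huw (hB1 u ⟨hu, hxu⟩ w ⟨hw, hxw⟩)
  · obtain ⟨c, hc⟩ := exists_adj_of_connDomNumber_eq_three h.2.1 x
    -- The edge missing a neighbour `c` of `x` provides a second neighbour of `x`.
    obtain ⟨a, b, hab, ha⟩ := exists_isMissPair_near hV hc.ne
    replace ha : G.Adj x a := ha.resolve_left (fun h => hab.not_adj_left (h ▸ hc))
    have : ({c, a} : Finset V).card ≤ G.degree x := by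
      rw [← card_neighborFinset_eq_degree]
      refine Finset.card_le_card fun z hz => ?_
      rcases Finset.mem_insert.1 hz with rfl | hz
      · simpa using hc
      · rw [Finset.mem_singleton.1 hz]; simpa using ha
    rw [Finset.card_pair hab.ne_left.symm] at this
    omega

end SimpleGraph

/-! ### The extremal graphs -/

namespace ClassG1Vertex

open SimpleGraph

variable {l : ℕ}

theorem classG1_not_isDomPair (hl : 2 ≤ l) (p q : ClassG1Vertex l) :
    ¬ (classG1 l).IsDomPair p q := by
  have : Nontrivial (Fin l) := Fin.nontrivial_iff_two_le.2 hl
  rintro ⟨hpq, hdom⟩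
  have hv := hdom (v l)
  rcases p with ⟨⟩ | i | i <;> rcases q with ⟨⟩ | j | j <;>
    simp only [classG1, classG1Adj, v, Sum.inr.injEq, Sum.inl.injEq, reduceCtorEq, or_false,
      false_or, or_self, or_true] at hpq hv
  · have := hdom (ClassG1Vertex.q ⟨0, by omega⟩)
    simp [classG1, classG1Adj] at this
  · have := hdom (ClassG1Vertex.q j)
    simp [classG1, classG1Adj] at this
  · have := hdom (ClassG1Vertex.q i)
    simp [classG1, classG1Adj] at this
  · subst hpq
    obtain ⟨k, hk⟩ := exists_ne i
    have := hdom (z k)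
    simp [classG1, classG1Adj, hk] at this
  · have := hdom (z j)
    simp [classG1, classG1Adj, Ne.symm hpq] at this
  · have := hdom (z i)
    simp [classG1, classG1Adj, hpq] at this

theorem classG1_connDomNumber (hl : 2 ≤ l) : (classG1 l).connDomNumber = 3 := by
  refine le_antisymm ?_ ?_
  · have : Nontrivial (Fin l) := Fin.nontrivial_iff_two_le.2 hl
    obtain ⟨i, j, hij⟩ := exists_pair_ne (Fin l)
    have h1 : (classG1 l).Adj (v l) (z i) := trivial
    have h2 : (classG1 l).Adj (z i) (q j) := hij
    have hD : (classG1 l).IsConnDomSet ({v l, z i} ∪ {z i, q j}) := by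
      refine ⟨fun a => ?_, induce_union_connected (induce_pair_connected_of_adj h1).preconnected
        (induce_pair_connected_of_adj h2).preconnected ⟨z i, by simp⟩⟩
      rcases a with ⟨⟩ | k | k
      · exact Or.inl (by simp)
      · exact Or.inr ⟨v l, by simp, trivial⟩
      · by_cases hk : j = k
        · exact Or.inl (by simp [hk])
        · exact Or.inr ⟨q j, by simp, hk⟩
    refine (connDomNumber_le hD).trans ?_
    have : (({v l, z i} ∪ {z i, q j} : Set (ClassG1Vertex l))) = {v l, z i, q j} := by
      ext a; simp only [Set.mem_union, Set.mem_insert_iff, Set.mem_singleton_iff]; tauto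
    rw [this]
    refine (Set.encard_insert_le _ _).trans ?_
    refine (add_le_add_left (Set.encard_insert_le _ _) 1).trans ?_
    rw [Set.encard_singleton]
    norm_num
  · by_contra! h
    obtain ⟨p, q, hpq⟩ := connDomNumber_lt_three_iff.1 h
    exact classG1_not_isDomPair hl p q hpq

theorem classG1_isConnDomEdgeCritical (hl : 2 ≤ l) : (classG1 l).IsConnDomEdgeCritical 3 := by
  refine ⟨classG1_connDomNumber hl, fun a b hab hnab => connDomNumber_lt_three_iff.2 ?_⟩
  have hvq : ∀ i, ((classG1 l) ⊔ edge (v l) (q i)).IsDomPair (v l) (q i) := by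
    refine fun i => ⟨Or.inr ?_, fun a => ?_⟩
    · simp [edge_adj]
    · rcases a with ⟨⟩ | k | k
      · simp
      · simp [classG1, classG1Adj]
      · by_cases hk : k = i
        · simp [hk]
        · simp [classG1, classG1Adj, Ne.symm hk]
  have hzq : ∀ i, ((classG1 l) ⊔ edge (z i) (q i)).IsDomPair (z i) (q i) := by
    refine fun i => ⟨Or.inr ?_, fun a => ?_⟩
    · simp [edge_adj]
    · rcases a with ⟨⟩ | k | k
      · simp [classG1, classG1Adj]
      · by_cases hk : k = i
        · simp [hk]
        · simp [classG1, classG1Adj, Ne.symm hk]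
      · by_cases hk : k = i
        · simp [hk]
        · simp [classG1, classG1Adj, Ne.symm hk]
  rcases a with ⟨⟩ | i | i <;> rcases b with ⟨⟩ | j | j
  · exact absurd rfl hab
  · exact absurd trivial hnab
  · exact ⟨_, _, hvq j⟩
  · exact absurd trivial hnab
  · have hij : i ≠ j := fun h => hab (by rw [h])
    -- In `G` this edge misses only `z j`, which the new edge attaches to `z i`.
    refine ⟨z i, q j, Or.inr (Or.inl hij), fun a => ?_⟩
    rcases a with ⟨⟩ | k | k
    · simp [classG1, classG1Adj]
    · by_cases hk : k = j
      · simp [hk, edge_adj, hij]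
      · simp [classG1, classG1Adj, Ne.symm hk]
    · by_cases hk : k = j
      · simp [hk]
      · simp [classG1, classG1Adj, Ne.symm hk]
  · obtain rfl : i = j := by
      by_contra h
      exact hnab h
    exact ⟨_, _, hzq i⟩
  · rw [edge_comm]
    exact ⟨_, _, hvq i⟩
  · obtain rfl : i = j := by
      by_contra h
      exact hnab h
    rw [edge_comm]
    exact ⟨_, _, hzq i⟩
  · exact absurd (fun h => hab (by rw [h])) hnab

theorem classG1_isConnDomVertexCritical (hl : 2 ≤ l) :
    (classG1 l).IsConnDomVertexCritical 3 := by
  have : Nontrivial (Fin l) := Fin.nontrivial_iff_two_le.2 hl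
  refine ⟨classG1_connDomNumber hl, fun a => connDomNumber_lt_three_iff.2 ?_⟩
  rcases a with ⟨⟩ | i | i
  · obtain ⟨i, j, hij⟩ := exists_pair_ne (Fin l)
    refine ⟨⟨q i, by simp⟩, ⟨q j, by simp⟩, Or.inr hij, ?_⟩
    rintro ⟨⟨⟩ | k | k, hk⟩
    · exact absurd rfl hk
    · simp only [Subtype.mk.injEq, classG1, classG1Adj, comap_adj,
        Function.Embedding.subtype_apply]
      grind
    · simp only [Subtype.mk.injEq, classG1, classG1Adj, comap_adj,
        Function.Embedding.subtype_apply]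
      grind
  · obtain ⟨j, hj⟩ := exists_ne i
    refine ⟨⟨q i, by simp⟩, ⟨z j, by simpa using hj⟩, Or.inr hj.symm, ?_⟩
    rintro ⟨⟨⟩ | k | k, hk⟩ <;>
      simp only [Subtype.mk.injEq, classG1, classG1Adj, comap_adj,
        Function.Embedding.subtype_apply, Set.mem_compl_iff, Set.mem_singleton_iff] at hk ⊢ <;>
      grind
  · refine ⟨⟨z i, by simp⟩, ⟨v l, by simp⟩, Or.inr trivial, ?_⟩
    rintro ⟨⟨⟩ | k | k, hk⟩ <;>
      simp only [Subtype.mk.injEq, classG1, classG1Adj, comap_adj,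
        Function.Embedding.subtype_apply, Set.mem_compl_iff, Set.mem_singleton_iff] at hk ⊢ <;>
      grind

theorem classG1_neighborFinset_v :
    (classG1 l).neighborFinset (v l) = Finset.univ.image (z : Fin l → ClassG1Vertex l) := by
  ext a
  rw [mem_neighborFinset]
  rcases a with ⟨⟩ | k | k <;> simp [classG1, classG1Adj]

theorem classG1_degree_v : (classG1 l).degree (v l) = l := by
  rw [← card_neighborFinset_eq_degree, classG1_neighborFinset_v,
    Finset.card_image_of_injective _ (fun a b h => by simpa using h), Finset.card_fin]

theorem classG1_isIndepSet_neighborFinset_v :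
    (classG1 l).IsIndepSet ((classG1 l).neighborFinset (v l) : Set (ClassG1Vertex l)) := by
  rw [classG1_neighborFinset_v]
  intro a ha b hb _
  simp only [Finset.coe_image, Finset.coe_univ, Set.image_univ, Set.mem_range] at ha hb
  obtain ⟨i, rfl⟩ := ha
  obtain ⟨j, rfl⟩ := hb
  exact id

end ClassG1Vertex

/-- Every finite maximal `3`-`γ_c`-vertex critical graph satisfies `α ≤ δ`; and for every `l ≥ 2`
the graph in `𝒢₁(l)` is such a graph, in which `v` has minimum degree `l` and `N(v)` is a maximum
independent set, so that `α = δ = l`. -/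
theorem theorem3p3 :
    (∀ (V : Type u) [Fintype V] (G : SimpleGraph V) [DecidableRel G.Adj],
      G.IsMaximalConnDomVertexCritical 3 → G.indepNum ≤ G.minDegree) ∧
    (∀ l : ℕ, 2 ≤ l →
      (classG1 l).IsMaximalConnDomVertexCritical 3 ∧
      (classG1 l).degree (ClassG1Vertex.v l) = (classG1 l).minDegree ∧
      (classG1 l).IsMaximumIndepSet ((classG1 l).neighborFinset (ClassG1Vertex.v l)) ∧
      (classG1 l).minDegree = l ∧
      (classG1 l).indepNum = (classG1 l).minDegree) := by
  refine ⟨fun V _ G _ h => ?_, fun l hl => ?_⟩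
  · obtain ⟨I, hI⟩ := G.exists_isNIndepSet_indepNum
    have : Nonempty V := by
      have hlt : G.connDomNumber < ⊤ := by rw [h.2.1]; exact ENat.natCast_lt_top 3
      simp only [SimpleGraph.connDomNumber, iInf_lt_iff] at hlt
      obtain ⟨D, hD, -⟩ := hlt
      exact hD.2.nonempty.map Subtype.val
    refine G.le_minDegree_of_forall_le_degree _ fun x => ?_
    rw [← hI.card_eq]
    exact h.card_le_degree hI.isIndepSet x
  · have hcrit : (classG1 l).IsMaximalConnDomVertexCritical 3 :=
      ⟨ClassG1Vertex.classG1_isConnDomEdgeCritical hl,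
        ClassG1Vertex.classG1_isConnDomVertexCritical hl⟩
    have hdeg := ClassG1Vertex.classG1_degree_v (l := l)
    have hmin : (classG1 l).minDegree = l := by
      refine le_antisymm (((classG1 l).minDegree_le_degree _).trans_eq hdeg) ?_
      refine (classG1 l).le_minDegree_of_forall_le_degree _ fun x => ?_
      -- The general bound, applied to `N(v)`, replaces a computation of the other degrees.
      have := hcrit.card_le_degree ClassG1Vertex.classG1_isIndepSet_neighborFinset_v x
      exact (hdeg.symm.trans (SimpleGraph.card_neighborFinset_eq_degree _ _).symm).trans_le this
    have hmax : (classG1 l).IsMaximumIndepSet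
        ((classG1 l).neighborFinset (ClassG1Vertex.v l)) := by
      refine ⟨ClassG1Vertex.classG1_isIndepSet_neighborFinset_v, fun t ht => ?_⟩
      exact (hcrit.card_le_degree ht _).trans_eq
        (SimpleGraph.card_neighborFinset_eq_degree _ _).symm
    refine ⟨hcrit, hdeg.trans hmin.symm, hmax, hmin, ?_⟩
    exact (SimpleGraph.maximumIndepSet_card_eq_indepNum _ hmax).symm.trans
      ((SimpleGraph.card_neighborFinset_eq_degree _ _).trans (hdeg.trans hmin.symm))
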